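/- Let $\mathcal{H}$ be a separable complex Hilbert space. Let $\mathbb{P}(\mathcal{H})=\{|\psi\rangle\langle\psi| : \psi\in\mathcal{H},\ \|\psi\|=1\}$ be the set of pure states (rank-one orthogonal projections) and, for $p\in\{1,2\}$, let $\mathcal{T}_p(\mathcal{H})$ be the real vector space of bounded self-adjoint operators $X$ on $\mathcal{H}$ with $\|X\|_p:=(\operatorname{Tr}|X|^p)^{1/p}<\infty$, so that $\mathbb{P}(\mathcal{H})\subseteq\mathcal{T}_1(\mathcal{H})$. Let $\varepsilon\in\mathbb{R}$ and let $f:\mathbb{P}(\mathcal{H})\to\mathcal{T}_2(\mathcal{H})$ be a map such that $$\left|\operatorname{Tr} f(X)f(Y)-\operatorname{Tr}XY\right|\le\varepsilon\qquad\text{for all }X,Y\in\mathbb{P}(\mathcal{H}).$$ (i) For every $A\in\mathcal{T}_2(\mathcal{H})$ with $\|A\|_2\le 1$ there is a real-linear map $T_A:\mathcal{T}_1(\mathcal{H})\to\mathcal{T}_2(\mathcal{H})$ such that $$\left|\operatorname{Tr}\big[A\big(f(X)-T_A(X)\big)\big]\right|\le 4\sqrt{\varepsilon}\qquad\text{for all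 }X\in\mathbb{P}(\mathcal{H}).$$ (ii) If $\mathcal{H}$ has finite dimension $d$ (that is, $\mathcal{H}=\mathbb{C}^d$ up to unitary equivalence), there is a real-linear map $T:\mathcal{T}_1(\mathcal{H})\to\mathcal{T}_2(\mathcal{H})$ such that $$\|f(X)-T(X)\|_2\le 4d\sqrt{\varepsilon}\qquad\text{for all }X\in\mathbb{P}(\mathcal{H}).$$ -/

import Mathlib

open scoped ENNReal InnerProductSpace

noncomputable section

namespace Schatten

/-! ### Trace and Schatten norms of bounded operators on a complex Hilbert space -/

section Definitions

variable (H : Type*) [NormedAddCommGroup H] [InnerProductSpace ℂ H] [CompleteSpace H]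

/-- The index set of a fixed orthonormal (Hilbert) basis of `H`. -/
def basisIndex : Set H := (exists_hilbertBasis ℂ H).choose

/-- A fixed orthonormal (Hilbert) basis of `H`. The notions below do not depend on this choice,
see `posTrace_eq_tsum` and `hasSum_trace_mul`. -/
def basis : HilbertBasis (basisIndex H) ℂ H := (exists_hilbertBasis ℂ H).choose_spec.choose

variable {H}

/-- The trace, with values in `[0, ∞]`, of a positive bounded operator. -/
def posTrace (P : H →L[ℂ] H) : ℝ≥0∞ :=
  ∑' i, ENNReal.ofReal (⟪basis H i, P (basis H i)⟫_ℂ).re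

/-- The trace of a trace class operator (for instance, of a product of two Hilbert–Schmidt
operators). -/
def trace (X : H →L[ℂ] H) : ℂ := ∑' i, ⟪basis H i, X (basis H i)⟫_ℂ

/-- The Schatten norm `‖X‖_p = (Tr |X|^p)^(1/p)`, with values in `[0, ∞]`; the absolute value
`|X| = (X* X)^(1/2)` and its powers are given by the continuous functional calculus. -/
def schattenNorm (p : ℝ) (X : H →L[ℂ] H) : ℝ≥0∞ := posTrace (CFC.abs X ^ p) ^ (1 / p)

variable (H)

/-- The set underlying the hermitian Schatten class `T_p(H)`. -/
def hermitianClass (p : ℝ) : Set (H →L[ℂ] H) :=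
  {X | IsSelfAdjoint X ∧ schattenNorm p X < ∞}

/-- The set `ℙ(H)` of pure states `|ψ⟩⟨ψ|`, `‖ψ‖ = 1`. -/
def pureStates : Set (H →L[ℂ] H) :=
  {X | ∃ ψ : H, ‖ψ‖ = 1 ∧ X = InnerProductSpace.rankOne ℂ ψ ψ}

end Definitions

/-! ### The facts that make `T_1(H)` and `T_2(H)` real vector spaces, and that the trace does not
depend on the basis -/

section Facts

variable {H : Type*} [NormedAddCommGroup H] [InnerProductSpace ℂ H] [CompleteSpace H]
variable {ι κ : Type*}

set_option linter.unusedSectionVars false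

theorem tsum_enorm_inner_sq (b : HilbertBasis ι ℂ H) (x : H) :
    ∑' i, ‖⟪b i, x⟫_ℂ‖ₑ ^ 2 = ‖x‖ₑ ^ 2 := by
  have h := (Complex.hasSum_re (b.hasSum_inner_mul_inner x x))
  have h2 : ∀ i, (⟪x, b i⟫_ℂ * ⟪b i, x⟫_ℂ).re = ‖⟪b i, x⟫_ℂ‖ ^ 2 := by
    intro i
    rw [← inner_conj_symm x (b i), ← Complex.normSq_eq_conj_mul_self, Complex.ofReal_re,
      Complex.normSq_eq_norm_sq]
  simp only [h2] at h
  have h3 : (⟪x, x⟫_ℂ).re = ‖x‖ ^ 2 := by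
    rw [inner_self_eq_norm_sq_to_K]; norm_cast
  rw [h3] at h
  have h4 := ENNReal.ofReal_tsum_of_nonneg (fun i => by positivity) h.summable
  rw [h.tsum_eq] at h4
  simp only [← ofReal_norm, ← ENNReal.ofReal_pow (norm_nonneg _)]
  exact h4.symm

theorem tsum_enorm_sq_adjoint (b : HilbertBasis ι ℂ H) (c : HilbertBasis κ ℂ H)
    (A : H →L[ℂ] H) : ∑' i, ‖A (b i)‖ₑ ^ 2 = ∑' j, ‖(star A) (c j)‖ₑ ^ 2 := by
  calc ∑' i, ‖A (b i)‖ₑ ^ 2 = ∑' i, ∑' j, ‖⟪c j, A (b i)⟫_ℂ‖ₑ ^ 2 := by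
        simp only [tsum_enorm_inner_sq]
    _ = ∑' j, ∑' i, ‖⟪b i, (star A) (c j)⟫_ℂ‖ₑ ^ 2 := by
        rw [ENNReal.tsum_comm]
        congr 1; ext j; congr 1; ext i
        rw [ContinuousLinearMap.star_eq_adjoint, ContinuousLinearMap.adjoint_inner_right,
          ← inner_conj_symm (A (b i)) (c j), RCLike.enorm_conj]
    _ = _ := by simp only [tsum_enorm_inner_sq]

theorem tsum_enorm_sq_eq (b : HilbertBasis ι ℂ H) (c : HilbertBasis κ ℂ H)
    (A : H →L[ℂ] H) : ∑' i, ‖A (b i)‖ₑ ^ 2 = ∑' j, ‖A (c j)‖ₑ ^ 2 := by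
  rw [tsum_enorm_sq_adjoint b c, tsum_enorm_sq_adjoint c c A]

theorem ofReal_inner_star_mul_self (A : H →L[ℂ] H) (x : H) :
    ENNReal.ofReal (⟪x, (star A * A) x⟫_ℂ).re = ‖A x‖ₑ ^ 2 := by
  rw [mul_apply_eq_comp, ContinuousLinearMap.star_eq_adjoint,
    ContinuousLinearMap.adjoint_inner_right, inner_self_eq_norm_sq_to_K, ← ofReal_norm,
    ← ENNReal.ofReal_pow (norm_nonneg _)]
  norm_cast

theorem posTrace_star_mul_self (A : H →L[ℂ] H) :
    posTrace (star A * A) = ∑' i, ‖A (basis H i)‖ₑ ^ 2 := by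
  simp only [posTrace, ofReal_inner_star_mul_self]

theorem posTrace_eq_sqrt {P : H →L[ℂ] H} (hP : 0 ≤ P) :
    posTrace P = ∑' i, ‖CFC.sqrt P (basis H i)‖ₑ ^ 2 := by
  rw [← posTrace_star_mul_self, (CFC.sqrt_nonneg P).isSelfAdjoint.star_eq,
    CFC.sqrt_mul_sqrt_self P hP]

/-- The trace of a positive operator does not depend on the basis. -/
theorem posTrace_eq_tsum {P : H →L[ℂ] H} (hP : 0 ≤ P) (b : HilbertBasis ι ℂ H) :
    posTrace P = ∑' i, ENNReal.ofReal (⟪b i, P (b i)⟫_ℂ).re := by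
  rw [posTrace_eq_sqrt hP, tsum_enorm_sq_eq (basis H) b]
  congr 1; ext i
  rw [← ofReal_inner_star_mul_self, (CFC.sqrt_nonneg P).isSelfAdjoint.star_eq,
    CFC.sqrt_mul_sqrt_self P hP]

theorem inner_re_nonneg {P : H →L[ℂ] H} (hP : 0 ≤ P) (x : H) : 0 ≤ (⟪x, P x⟫_ℂ).re :=
  ((ContinuousLinearMap.nonneg_iff_isPositive P).1 hP).re_inner_nonneg_right x

theorem inner_re_mono {P Q : H →L[ℂ] H} (h : P ≤ Q) (x : H) :
    (⟪x, P x⟫_ℂ).re ≤ (⟪x, Q x⟫_ℂ).re := by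
  have := inner_re_nonneg (sub_nonneg.2 h) x
  rw [sub_apply, inner_sub_right, Complex.sub_re] at this
  linarith

theorem posTrace_mono {P Q : H →L[ℂ] H} (h : P ≤ Q) : posTrace P ≤ posTrace Q :=
  ENNReal.tsum_le_tsum fun _ => ENNReal.ofReal_le_ofReal (inner_re_mono h _)

theorem posTrace_add {P Q : H →L[ℂ] H} (hP : 0 ≤ P) (hQ : 0 ≤ Q) :
    posTrace (P + Q) = posTrace P + posTrace Q := by
  rw [posTrace, posTrace, posTrace, ← ENNReal.tsum_add]
  congr 1; ext i
  rw [add_apply, inner_add_right, Complex.add_re,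
    ENNReal.ofReal_add (inner_re_nonneg hP _) (inner_re_nonneg hQ _)]

theorem sum_inner_mul_le {P G : H →L[ℂ] H} (hP : 0 ≤ P) (hG : ‖G‖ ≤ 1) (hfin : posTrace P < ∞)
    (F : Finset (basisIndex H)) :
    ∑ i ∈ F, (⟪basis H i, (P * G) (basis H i)⟫_ℂ).re ≤ (posTrace P).toReal := by
  set S := CFC.sqrt P with hS
  have hSs : star S = S := (CFC.sqrt_nonneg P).isSelfAdjoint.star_eq
  have hSS : S * S = P := CFC.sqrt_mul_sqrt_self P hP
  have h1 : ∑' i, ‖S (basis H i)‖ₑ ^ 2 = posTrace P := (posTrace_eq_sqrt hP).symm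
  have h2 : ∑' i, ‖(S * G) (basis H i)‖ₑ ^ 2 ≤ posTrace P := by
    rw [tsum_enorm_sq_adjoint (basis H) (basis H), star_mul, hSs, ← h1]
    refine ENNReal.tsum_le_tsum fun i => ?_
    gcongr
    rw [← ofReal_norm, ← ofReal_norm]
    refine ENNReal.ofReal_le_ofReal ?_
    rw [mul_apply_eq_comp]
    calc _ ≤ ‖star G‖ * ‖S (basis H i)‖ := (star G).le_opNorm _
      _ ≤ 1 * ‖S (basis H i)‖ := by
        rw [norm_star]; gcongr
      _ = _ := one_mul _
  have key : ∀ A : H →L[ℂ] H, ∑' i, ‖A (basis H i)‖ₑ ^ 2 ≤ posTrace P →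
      ∑ i ∈ F, ‖A (basis H i)‖ ^ 2 ≤ (posTrace P).toReal := by
    intro A hA
    have h3 := (ENNReal.sum_le_tsum F).trans hA
    have h4 := ENNReal.toReal_mono hfin.ne h3
    rw [ENNReal.toReal_sum (fun i _ => by finiteness)] at h4
    simpa using h4
  have hpt : ∀ i, (⟪basis H i, (P * G) (basis H i)⟫_ℂ).re ≤
      (‖S (basis H i)‖ ^ 2 + ‖(S * G) (basis H i)‖ ^ 2) / 2 := by
    intro i
    have : ⟪basis H i, (P * G) (basis H i)⟫_ℂ = ⟪S (basis H i), (S * G) (basis H i)⟫_ℂ := by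
      rw [← hSS, mul_assoc, mul_apply_eq_comp]
      nth_rw 1 [← hSs]
      rw [ContinuousLinearMap.star_eq_adjoint, ContinuousLinearMap.adjoint_inner_right]
    rw [this]
    have h5 := (Complex.re_le_norm _).trans (norm_inner_le_norm (𝕜 := ℂ) (S (basis H i))
      ((S * G) (basis H i)))
    nlinarith [sq_nonneg (‖S (basis H i)‖ - ‖(S * G) (basis H i)‖)]
  calc _ ≤ ∑ i ∈ F, (‖S (basis H i)‖ ^ 2 + ‖(S * G) (basis H i)‖ ^ 2) / 2 :=
        Finset.sum_le_sum fun i _ => hpt i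
    _ = (∑ i ∈ F, ‖S (basis H i)‖ ^ 2 + ∑ i ∈ F, ‖(S * G) (basis H i)‖ ^ 2) / 2 := by
        rw [← Finset.sum_add_distrib, Finset.sum_div]
    _ ≤ _ := by linarith [key S h1.le, key (S * G) h2]

/-- A difference of positive operators of finite trace is trace class. -/
theorem posTrace_abs_sub_lt_top {P Q : H →L[ℂ] H} (hP : 0 ≤ P) (hQ : 0 ≤ Q)
    (hP' : posTrace P < ∞) (hQ' : posTrace Q < ∞) : posTrace (CFC.abs (P - Q)) < ∞ := by
  set Z := P - Q with hZdef
  have hZ : IsSelfAdjoint Z := hP.isSelfAdjoint.sub hQ.isSelfAdjoint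
  set C := (posTrace P).toReal + (posTrace Q).toReal with hC
  have hfinsum : ∀ F : Finset (basisIndex H),
      ∑ i ∈ F, (⟪basis H i, CFC.abs Z (basis H i)⟫_ℂ).re ≤ C := by
    intro F
    refine le_of_forall_pos_le_add fun δ hδ => ?_
    obtain ⟨e, he, heF⟩ : ∃ e : ℝ, 0 < e ∧ e * F.card ≤ δ := by
      refine ⟨δ / (F.card + 1), by positivity, ?_⟩
      rw [div_mul_eq_mul_div, div_le_iff₀ (by positivity)]
      nlinarith
    set g : ℝ → ℝ := fun x => x / (|x| + e) with hg
    have hpos : ∀ x : ℝ, 0 < |x| + e := fun x => by positivity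
    have hgc : Continuous g := continuous_id.div (continuous_abs.add continuous_const)
      fun x => (hpos x).ne'
    set G := cfc g Z with hG
    have hG1 : ‖G‖ ≤ 1 := by
      refine norm_cfc_le zero_le_one fun x _ => ?_
      rw [Real.norm_eq_abs, hg]
      simp only [abs_div, abs_of_pos (hpos x)]
      rw [div_le_one (hpos x)]
      linarith
    have hle : CFC.abs Z ≤ Z * G + algebraMap ℝ (H →L[ℂ] H) e := by
      have e1 : Z * G + algebraMap ℝ (H →L[ℂ] H) e = cfc (fun x => x * g x + e) Z := by
        rw [cfc_add (a := Z) (fun x => x * g x) (fun _ => e) (by fun_prop) (by fun_prop),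
          cfc_mul (a := Z) (fun x => x) g (by fun_prop) (by fun_prop), cfc_id' ℝ Z,
          cfc_const e Z]
      rw [e1, CFC.abs_eq_cfc_norm Z hZ]
      refine cfc_mono (fun x _ => ?_) (by fun_prop) (by fun_prop)
      rw [Real.norm_eq_abs, hg]
      have : x * (x / (|x| + e)) = |x| ^ 2 / (|x| + e) := by
        rw [sq_abs]; ring
      simp only [this]
      rw [← sub_le_iff_le_add, le_div_iff₀ (hpos x)]
      nlinarith
    have hterm : ∀ i, (⟪basis H i, CFC.abs Z (basis H i)⟫_ℂ).re ≤
        (⟪basis H i, (P * G) (basis H i)⟫_ℂ).re + (⟪basis H i, (Q * (-G)) (basis H i)⟫_ℂ).re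
          + e := by
      intro i
      refine (inner_re_mono hle (basis H i)).trans_eq ?_
      have e2 : Z * G + algebraMap ℝ (H →L[ℂ] H) e =
          P * G + Q * (-G) + algebraMap ℝ (H →L[ℂ] H) e := by
        rw [hZdef, sub_mul, mul_neg, sub_eq_add_neg]
      have hn : ‖basis H i‖ = 1 := (basis H).orthonormal.1 i
      have e3 : (⟪basis H i, (algebraMap ℝ (H →L[ℂ] H) e) (basis H i)⟫_ℂ).re = e := by
        rw [Algebra.algebraMap_eq_smul_one, smul_apply,
          one_apply_eq_self, inner_smul_right_eq_smul, inner_self_eq_norm_sq_to_K, hn]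
        simp
      rw [e2, add_apply, add_apply, inner_add_right,
        inner_add_right, Complex.add_re, Complex.add_re, e3]
    calc _ ≤ _ := Finset.sum_le_sum fun i _ => hterm i
      _ ≤ _ := by
        rw [Finset.sum_add_distrib, Finset.sum_add_distrib, Finset.sum_const, nsmul_eq_mul]
        have h1 := sum_inner_mul_le hP hG1 hP' F
        have h2 := sum_inner_mul_le hQ (G := -G) (by rwa [norm_neg]) hQ' F
        linarith
  refine lt_of_le_of_lt ?_ (ENNReal.ofReal_lt_top (r := C))
  rw [posTrace, ENNReal.tsum_eq_iSup_sum]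
  refine iSup_le fun F => ?_
  rw [← ENNReal.ofReal_sum_of_nonneg fun i _ => inner_re_nonneg (CFC.abs_nonneg Z) _]
  exact ENNReal.ofReal_le_ofReal (hfinsum F)

theorem schattenNorm_one (X : H →L[ℂ] H) : schattenNorm 1 X = posTrace (CFC.abs X) := by
  rw [schattenNorm, CFC.rpow_one _ (CFC.abs_nonneg X)]
  simp

theorem schattenNorm_two (X : H →L[ℂ] H) :
    schattenNorm 2 X = (∑' i, ‖X (basis H i)‖ₑ ^ 2) ^ (1 / 2 : ℝ) := by
  have h := CFC.rpow_natCast (CFC.abs X) 2 (CFC.abs_nonneg X)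
  rw [Nat.cast_ofNat] at h
  rw [schattenNorm, h, CFC.abs_sq, posTrace_star_mul_self]

theorem schattenNorm_two_lt_top_iff (X : H →L[ℂ] H) :
    schattenNorm 2 X < ∞ ↔ ∑' i, ‖X (basis H i)‖ₑ ^ 2 < ∞ := by
  rw [schattenNorm_two, ENNReal.rpow_lt_top_iff_of_pos (by norm_num)]

theorem mem_hermitianClass_one_iff {X : H →L[ℂ] H} :
    X ∈ hermitianClass H 1 ↔ IsSelfAdjoint X ∧ posTrace (CFC.abs X) < ∞ := by
  rw [hermitianClass, Set.mem_ofPred_eq, schattenNorm_one]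

theorem mem_hermitianClass_two_iff {X : H →L[ℂ] H} :
    X ∈ hermitianClass H 2 ↔ IsSelfAdjoint X ∧ ∑' i, ‖X (basis H i)‖ₑ ^ 2 < ∞ := by
  rw [hermitianClass, Set.mem_ofPred_eq, schattenNorm_two_lt_top_iff]

theorem posTrace_smul {r : ℝ} (hr : 0 ≤ r) (P : H →L[ℂ] H) :
    posTrace (r • P) = ENNReal.ofReal r * posTrace P := by
  rw [posTrace, posTrace, ← ENNReal.tsum_mul_left]
  congr 1; ext i
  rw [smul_apply, inner_smul_right_eq_smul, Complex.smul_re, smul_eq_mul,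
    ENNReal.ofReal_mul hr]

theorem add_mem_one {X Y : H →L[ℂ] H} (hX : X ∈ hermitianClass H 1)
    (hY : Y ∈ hermitianClass H 1) : X + Y ∈ hermitianClass H 1 := by
  rw [mem_hermitianClass_one_iff] at *
  obtain ⟨hX, hX'⟩ := hX
  obtain ⟨hY, hY'⟩ := hY
  refine ⟨hX.add hY, ?_⟩
  have e : X + Y = (X⁺ + Y⁺) - (X⁻ + Y⁻) := by
    nth_rw 1 [← CFC.posPart_sub_negPart X hX, ← CFC.posPart_sub_negPart Y hY]
    abel
  rw [← CFC.posPart_add_negPart X hX,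
    posTrace_add (CFC.posPart_nonneg X) (CFC.negPart_nonneg X), ENNReal.add_lt_top] at hX'
  rw [← CFC.posPart_add_negPart Y hY,
    posTrace_add (CFC.posPart_nonneg Y) (CFC.negPart_nonneg Y), ENNReal.add_lt_top] at hY'
  rw [e]
  refine posTrace_abs_sub_lt_top (add_nonneg (CFC.posPart_nonneg X) (CFC.posPart_nonneg Y))
    (add_nonneg (CFC.negPart_nonneg X) (CFC.negPart_nonneg Y)) ?_ ?_
  · rw [posTrace_add (CFC.posPart_nonneg X) (CFC.posPart_nonneg Y)]
    exact ENNReal.add_lt_top.2 ⟨hX'.1, hY'.1⟩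
  · rw [posTrace_add (CFC.negPart_nonneg X) (CFC.negPart_nonneg Y)]
    exact ENNReal.add_lt_top.2 ⟨hX'.2, hY'.2⟩

theorem smul_mem_one (r : ℝ) {X : H →L[ℂ] H} (hX : X ∈ hermitianClass H 1) :
    r • X ∈ hermitianClass H 1 := by
  rw [mem_hermitianClass_one_iff] at *
  refine ⟨(IsSelfAdjoint.all r).smul hX.1, ?_⟩
  rw [CFC.abs_smul, posTrace_smul (norm_nonneg r)]
  exact ENNReal.mul_lt_top ENNReal.ofReal_lt_top hX.2

theorem tsum_enorm_sq_add_lt_top {X Y : H →L[ℂ] H} (b : HilbertBasis ι ℂ H)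
    (hX : ∑' i, ‖X (b i)‖ₑ ^ 2 < ∞) (hY : ∑' i, ‖Y (b i)‖ₑ ^ 2 < ∞) :
    ∑' i, ‖(X + Y) (b i)‖ₑ ^ 2 < ∞ := by
  have h : ∀ i, ‖(X + Y) (b i)‖ₑ ^ 2 ≤ 2 * (‖X (b i)‖ₑ ^ 2 + ‖Y (b i)‖ₑ ^ 2) := by
    intro i
    rw [add_apply]
    have h1 := enorm_add_le (X (b i)) (Y (b i))
    have h2 := ENNReal.rpow_add_le_mul_rpow_add_rpow ‖X (b i)‖ₑ ‖Y (b i)‖ₑ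
      (p := 2) (by norm_num)
    norm_num at h2
    exact (pow_le_pow_left' h1 2).trans h2
  refine (ENNReal.tsum_le_tsum h).trans_lt ?_
  rw [ENNReal.tsum_mul_left, ENNReal.tsum_add]
  exact ENNReal.mul_lt_top (by simp) (ENNReal.add_lt_top.2 ⟨hX, hY⟩)

theorem tsum_enorm_sq_smul_lt_top (z : ℂ) {X : H →L[ℂ] H} (b : HilbertBasis ι ℂ H)
    (hX : ∑' i, ‖X (b i)‖ₑ ^ 2 < ∞) : ∑' i, ‖(z • X) (b i)‖ₑ ^ 2 < ∞ := by
  simp only [smul_apply, enorm_smul, mul_pow]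
  rw [ENNReal.tsum_mul_left]
  exact ENNReal.mul_lt_top (by finiteness) hX

theorem add_mem_two {X Y : H →L[ℂ] H} (hX : X ∈ hermitianClass H 2)
    (hY : Y ∈ hermitianClass H 2) : X + Y ∈ hermitianClass H 2 := by
  rw [mem_hermitianClass_two_iff] at *
  exact ⟨hX.1.add hY.1, tsum_enorm_sq_add_lt_top _ hX.2 hY.2⟩

theorem smul_mem_two (r : ℝ) {X : H →L[ℂ] H} (hX : X ∈ hermitianClass H 2) :
    r • X ∈ hermitianClass H 2 := by
  rw [mem_hermitianClass_two_iff] at *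
  refine ⟨(IsSelfAdjoint.all r).smul hX.1, ?_⟩
  simp only [smul_apply, enorm_smul, mul_pow]
  rw [ENNReal.tsum_mul_left]
  exact ENNReal.mul_lt_top (by finiteness) hX.2

theorem pureStates_subset_one : pureStates H ⊆ hermitianClass H 1 := by
  rintro X ⟨ψ, hψ, rfl⟩
  have hpos : 0 ≤ InnerProductSpace.rankOne ℂ ψ ψ :=
    (ContinuousLinearMap.nonneg_iff_isPositive _).2 (InnerProductSpace.isPositive_rankOne_self ψ)
  rw [mem_hermitianClass_one_iff]
  refine ⟨hpos.isSelfAdjoint, ?_⟩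
  have h : posTrace (InnerProductSpace.rankOne ℂ ψ ψ) = ∑' i, ‖⟪basis H i, ψ⟫_ℂ‖ₑ ^ 2 := by
    rw [posTrace]
    congr 1; ext i
    rw [InnerProductSpace.rankOne_apply, inner_smul_right, ← inner_conj_symm ψ (basis H i),
      ← Complex.normSq_eq_conj_mul_self, Complex.ofReal_re, Complex.normSq_eq_norm_sq,
      ← ofReal_norm, ENNReal.ofReal_pow (norm_nonneg _)]
  rw [CFC.abs_of_nonneg _ hpos, h, tsum_enorm_inner_sq]
  finiteness

theorem hasSum_norm_sq {A : H →L[ℂ] H} (b : HilbertBasis ι ℂ H)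
    (hA : ∑' i, ‖A (basis H i)‖ₑ ^ 2 < ∞) :
    HasSum (fun i => ‖A (b i)‖ ^ 2) (∑' i, ‖A (basis H i)‖ₑ ^ 2).toReal := by
  rw [tsum_enorm_sq_eq (basis H) b] at hA ⊢
  have h := (ENNReal.summable_toReal hA.ne).hasSum
  rw [← ENNReal.tsum_toReal_eq (fun i => by finiteness)] at h
  simpa using h

theorem hasSum_inner_mul {A B : H →L[ℂ] H} (hA : A ∈ hermitianClass H 2)
    (hB : B ∈ hermitianClass H 2) (t : ℂ → ℂ)
    (ht : t = fun z => (((∑' i, ‖(A + z • B) (basis H i)‖ₑ ^ 2).toReal : ℝ) : ℂ))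
    (b : HilbertBasis ι ℂ H) : HasSum (fun i => ⟪b i, (A * B) (b i)⟫_ℂ)
      ((t 1 - t (-1) + (t (-Complex.I) - t Complex.I) * Complex.I) / 4) := by
  rw [mem_hermitianClass_two_iff] at hA hB
  have hs : ∀ z : ℂ, ∑' i, ‖(A + z • B) (basis H i)‖ₑ ^ 2 < ∞ := fun z =>
    tsum_enorm_sq_add_lt_top _ hA.2 (tsum_enorm_sq_smul_lt_top z _ hB.2)
  have h : ∀ z : ℂ, HasSum (fun i => ((‖(A + z • B) (b i)‖ ^ 2 : ℝ) : ℂ)) (t z) := by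
    intro z
    rw [ht]
    exact Complex.hasSum_ofReal.2 (hasSum_norm_sq b (hs z))
  have h' := ((((h 1).sub (h (-1))).add (((h (-Complex.I)).sub (h Complex.I)).mul_right
    Complex.I)).div_const 4)
  refine (congrArg (fun g => HasSum g _) (funext fun i => ?_)).mpr h'
  have e : ⟪b i, (A * B) (b i)⟫_ℂ = ⟪A (b i), B (b i)⟫_ℂ := by
    rw [mul_apply_eq_comp]
    nth_rw 1 [← hA.1.star_eq]
    rw [ContinuousLinearMap.star_eq_adjoint, ContinuousLinearMap.adjoint_inner_right]
  rw [e, inner_eq_sum_norm_sq_div_four]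
  simp [sub_eq_add_neg]

/-- The trace of a product of two hermitian Hilbert–Schmidt operators converges in every
orthonormal basis and does not depend on the basis. -/
theorem hasSum_trace_mul {A B : H →L[ℂ] H} (hA : A ∈ hermitianClass H 2)
    (hB : B ∈ hermitianClass H 2) (b : HilbertBasis ι ℂ H) :
    HasSum (fun i => ⟪b i, (A * B) (b i)⟫_ℂ) (trace (A * B)) := by
  rw [trace, (hasSum_inner_mul hA hB _ rfl (basis H)).tsum_eq]
  exact hasSum_inner_mul hA hB _ rfl b

end Facts

/-! ### The hermitian Schatten classes `T_1(H)` and `T_2(H)` as real vector spaces -/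

section Classes

variable (H : Type*) [NormedAddCommGroup H] [InnerProductSpace ℂ H] [CompleteSpace H]

/-- The real vector space `T_1(H)` of hermitian trace class operators. -/
def T1 : Submodule ℝ (H →L[ℂ] H) where
  carrier := hermitianClass H 1
  add_mem' := add_mem_one
  zero_mem' := by
    rw [mem_hermitianClass_one_iff]
    simp [posTrace]
  smul_mem' r _ := smul_mem_one r

/-- The real vector space `T_2(H)` of hermitian Hilbert–Schmidt operators. -/
def T2 : Submodule ℝ (H →L[ℂ] H) where
  carrier := hermitianClass H 2
  add_mem' := add_mem_two
  zero_mem' := by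
    rw [mem_hermitianClass_two_iff]
    simp
  smul_mem' r _ := smul_mem_two r

variable {H}

/-- A pure state, regarded as an element of `T_1(H)`. -/
def pureToT1 (X : pureStates H) : T1 H := ⟨X, pureStates_subset_one X.2⟩

end Classes

end Schatten

end

/-! The engine is a Hahn–Banach argument on the space of finitely supported coefficient families `c`
on pure states, with the `ℓ¹` norm. Regard the Hilbert–Schmidt operators as a real inner product
space with `⟪A, B⟫ = Tr AB`. If `∑ c_X X = 0`, then `‖∑ c_X f(X)‖²` is the quadratic form at `c` of
the difference of the two Gram matrices, whose entries are at most `ε`; hence `‖∑ c_X f(X)‖ ≤ √ε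
‖c‖₁` (`norm_linearCombination_le`).

So `g(X) = Tr A f(X)`, extended linearly to coefficient families, is bounded by `‖A‖₂ √ε ‖c‖₁` on
the linear relations between pure states. Extend this restriction to all families with the same
bound and subtract the extension: the difference kills every relation, so it is a linear functional
`l` of the operator `∑ c_X X`, and the error `g(X) - l(X)` is the extension evaluated at a unit
vector (`exists_linearMap_abs_sub_le`).

For (i), `T_A` is the functional `l` times `A / ‖A‖₂²`. For (ii), the functionals belonging to an
orthonormal basis are assembled into one map, and the squared errors are summed. Both constants come
out better than required: `1` in place of `4`, and `√2 d` in place of `4d`. -/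

namespace Schatten

/-! ### Approximating a function on a subset of a real vector space by a linear functional -/

section Approximation

variable {S E F : Type*} [AddCommGroup E] [Module ℝ E]

/-- A function `g` on a family `v` of vectors is within `δ` of a linear functional as soon as it
respects the linear relations of the family up to `δ` times the `ℓ¹` norm of the coefficients. -/
theorem exists_linearMap_abs_sub_le (v : S → E) (g : S → ℝ) {δ : ℝ} (hδ : 0 ≤ δ)
    (h : ∀ c : S →₀ ℝ, Finsupp.linearCombination ℝ v c = 0 →
      Finsupp.linearCombination ℝ g c ≤ δ * c.sum fun _ a => |a|) :
    ∃ l : E →ₗ[ℝ] ℝ, ∀ s, |g s - l (v s)| ≤ δ := by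
  set V := Finsupp.linearCombination ℝ v
  set G := Finsupp.linearCombination ℝ g
  -- Hahn–Banach: `G` restricted to the relations `ker V` is dominated by `δ` times the `ℓ¹` norm,
  -- and `G'` extends it under the same bound.
  obtain ⟨G', hG', hle⟩ := exists_extension_of_le_sublinear
    (⟨LinearMap.ker V, G.domRestrict (LinearMap.ker V)⟩ : (S →₀ ℝ) →ₗ.[ℝ] ℝ)
    (fun c => δ * c.sum fun _ a => |a|)
    (fun r hr c => by
      rw [Finsupp.sum_smul_index (by simp)]
      simp only [abs_mul, abs_of_pos hr, Finsupp.sum, ← Finset.mul_sum]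
      ring)
    (fun c c' => by
      classical
      rw [← mul_add]
      refine mul_le_mul_of_nonneg_left ?_ hδ
      rw [Finsupp.sum_of_support_subset (c + c') Finsupp.support_add _ (by simp),
        Finsupp.sum_of_support_subset c Finset.subset_union_left _ (by simp),
        Finsupp.sum_of_support_subset c' Finset.subset_union_right _ (by simp),
        ← Finset.sum_add_distrib]
      exact Finset.sum_le_sum fun i _ => abs_add_le _ _)
    (fun c => h c (LinearMap.mem_ker.1 c.2))
  have hker : LinearMap.ker V ≤ LinearMap.ker (G - G') := fun c hc => by
    have := hG' ⟨c, hc⟩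
    simp only [LinearMap.mem_ker, LinearMap.sub_apply, sub_eq_zero]
    exact this.symm
  -- A functional vanishing on `ker V` factors through `V`; over a field the factor can be taken on
  -- all of `E`.
  obtain ⟨l, hl⟩ : G - G' ∈ LinearMap.range V.dualMap := by
    rw [LinearMap.range_dualMap_eq_dualAnnihilator_ker, Submodule.mem_dualAnnihilator]
    exact fun c hc => hker hc
  refine ⟨l, fun s => ?_⟩
  have h1 : l (v s) = g s - G' (Finsupp.single s 1) := by
    simpa [V, G] using LinearMap.congr_fun hl (Finsupp.single s 1)
  -- The domination is one-sided, so it is tested at both signs of the unit vector, which has `ℓ¹`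
  -- norm 1.
  have h2 := hle (Finsupp.single s 1)
  have h3 := hle (-Finsupp.single s 1)
  rw [map_neg, Finsupp.sum_neg_index (by simp)] at h3
  simp only [abs_neg, abs_zero, abs_one, Finsupp.sum_single_index, mul_one] at h2 h3
  rw [h1, sub_sub_cancel, abs_le]
  constructor <;> linarith

variable [NormedAddCommGroup F] [InnerProductSpace ℝ F]

theorem inner_linearCombination_self (w : S → F) (c : S →₀ ℝ) :
    ⟪Finsupp.linearCombination ℝ w c, Finsupp.linearCombination ℝ w c⟫_ℝ =
      ∑ s ∈ c.support, ∑ t ∈ c.support, c s * c t * ⟪w s, w t⟫_ℝ := by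
  simp only [Finsupp.linearCombination_apply, Finsupp.sum, sum_inner, inner_sum,
    real_inner_smul_left, real_inner_smul_right, mul_assoc]
  exact Finset.sum_comm' (by simp) |>.trans
    (Finset.sum_congr rfl fun s _ => Finset.sum_congr rfl fun t _ => by ring)

/-- If two families of vectors have Gram matrices that differ entrywise by at most `ε`, the linear
relations of one hold for the other up to `√ε` times the `ℓ¹` norm of the coefficients. -/
theorem norm_linearCombination_le (u w : S → F) {ε : ℝ} (hε : 0 ≤ ε)
    (h : ∀ s t, |⟪w s, w t⟫_ℝ - ⟪u s, u t⟫_ℝ| ≤ ε) (c : S →₀ ℝ)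
    (hc : Finsupp.linearCombination ℝ u c = 0) :
    ‖Finsupp.linearCombination ℝ w c‖ ≤ √ε * c.sum fun _ a => |a| := by
  have hs : 0 ≤ c.sum fun _ a => |a| := Finset.sum_nonneg fun i _ => abs_nonneg _
  refine abs_le_of_sq_le_sq' ?_ (by positivity) |>.2
  have h0 := inner_linearCombination_self u c
  rw [hc, inner_zero_left] at h0
  -- By `h0` the Gram form of `u` vanishes at `c`, so it can be subtracted from that of `w`; only
  -- entrywise differences remain.
  rw [← real_inner_self_eq_norm_sq, inner_linearCombination_self, mul_pow, Real.sq_sqrt hε,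
    ← sub_zero (∑ s ∈ c.support, _), h0, ← Finset.sum_sub_distrib, sq, Finsupp.sum,
    Finset.sum_mul_sum, Finset.mul_sum]
  refine Finset.sum_le_sum fun s _ => ?_
  rw [← Finset.sum_sub_distrib, Finset.mul_sum]
  refine Finset.sum_le_sum fun t _ => ?_
  rw [← mul_sub]
  refine (le_abs_self _).trans ?_
  rw [abs_mul, abs_mul, mul_comm ε]
  exact mul_le_mul_of_nonneg_left (h s t) (by positivity)

/-- If two families of vectors have Gram matrices that differ entrywise by at most `ε`, every
linear functional of one is within `√ε` of a linear functional of the other. -/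
theorem exists_linearMap_inner_sub_le (v : S → E) (u w : S → F) {ε : ℝ} (hε : 0 ≤ ε)
    (h : ∀ s t, |⟪w s, w t⟫_ℝ - ⟪u s, u t⟫_ℝ| ≤ ε)
    (huv : ∀ c : S →₀ ℝ, Finsupp.linearCombination ℝ v c = 0 →
      Finsupp.linearCombination ℝ u c = 0) (a : F) :
    ∃ l : E →ₗ[ℝ] ℝ, ∀ s, |⟪a, w s⟫_ℝ - l (v s)| ≤ ‖a‖ * √ε := by
  refine exists_linearMap_abs_sub_le v (fun s => ⟪a, w s⟫_ℝ) (by positivity) fun c hc => ?_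
  have e : Finsupp.linearCombination ℝ (fun s => ⟪a, w s⟫_ℝ) c =
      ⟪a, Finsupp.linearCombination ℝ w c⟫_ℝ := by
    simp only [Finsupp.linearCombination_apply, Finsupp.sum, inner_sum, real_inner_smul_right,
      smul_eq_mul]
  rw [e, mul_assoc]
  exact (real_inner_le_norm _ _).trans
    (mul_le_mul_of_nonneg_left (norm_linearCombination_le u w hε h c (huv c hc)) (norm_nonneg a))

end Approximation

/-! ### Hilbert–Schmidt operators as square summable families -/

section Embedding

variable {H : Type*} [NormedAddCommGroup H] [InnerProductSpace ℂ H] [CompleteSpace H]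

theorem memℓp_apply_basis (A : T2 H) :
    Memℓp (fun i : basisIndex H => (A : H →L[ℂ] H) (basis H i)) 2 := by
  rw [memℓp_gen_iff (by norm_num)]
  simpa using (hasSum_norm_sq (basis H) (mem_hermitianClass_two_iff.1 A.2).2).summable

variable (H) in
/-- The square summable families of vectors indexed by the basis, as a real Hilbert space. -/
def SquareSummable : Type _ := lp (fun _ : basisIndex H => H) 2

noncomputable instance : NormedAddCommGroup (SquareSummable H) :=
  inferInstanceAs (NormedAddCommGroup (lp (fun _ : basisIndex H => H) 2))

/-- The real inner product is the real part of the complex one. -/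
noncomputable instance : InnerProductSpace ℝ (SquareSummable H) :=
  InnerProductSpace.complexToReal (G := lp (fun _ : basisIndex H => H) 2)

variable (H) in
/-- The isometric embedding of `T_2(H)` into the Hilbert space of square summable families given
by the images of the basis vectors. -/
noncomputable def toFamily : T2 H →ₗ[ℝ] SquareSummable H where
  toFun A := ⟨fun i => (A : H →L[ℂ] H) (basis H i), memℓp_apply_basis A⟩
  map_add' _ _ := rfl
  map_smul' _ _ := rfl

theorem inner_toFamily (A B : T2 H) :
    ⟪toFamily H A, toFamily H B⟫_ℝ = (trace ((A : H →L[ℂ] H) * (B : H →L[ℂ] H))).re := by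
  refine congrArg Complex.re ((lp.inner_eq_tsum (𝕜 := ℂ) _ _).trans ?_)
  rw [trace]
  congr 1; ext i
  have hA : IsSelfAdjoint (A : H →L[ℂ] H) := A.2.1
  change ⟪(A : H →L[ℂ] H) (basis H i), (B : H →L[ℂ] H) (basis H i)⟫_ℂ = _
  rw [mul_apply_eq_comp]
  nth_rw 2 [← hA.star_eq]
  rw [ContinuousLinearMap.star_eq_adjoint, ContinuousLinearMap.adjoint_inner_right]

theorem norm_toFamily_sq (A : T2 H) :
    ‖toFamily H A‖ ^ 2 = ∑' i, ‖(A : H →L[ℂ] H) (basis H i)‖ ^ 2 := by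
  have h := lp.norm_rpow_eq_tsum (p := 2) (by norm_num)
    (⟨_, memℓp_apply_basis A⟩ : lp (fun _ : basisIndex H => H) 2)
  simp only [ENNReal.toReal_ofNat, Real.rpow_ofNat] at h
  exact h

/-- By polarization the imaginary part is a multiple of the difference of the squared
Hilbert–Schmidt norms of `A + iB` and `A - iB`. These operators are adjoint to each other, so the
norms agree. -/
theorem trace_mul_im (A B : T2 H) : (trace ((A : H →L[ℂ] H) * (B : H →L[ℂ] H))).im = 0 := by
  have hA : IsSelfAdjoint (A : H →L[ℂ] H) := A.2.1
  have hB : IsSelfAdjoint (B : H →L[ℂ] H) := B.2.1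
  have h : ∑' i, ‖((A : H →L[ℂ] H) + Complex.I • (B : H →L[ℂ] H)) (basis H i)‖ₑ ^ 2 =
      ∑' i, ‖((A : H →L[ℂ] H) + (-Complex.I) • (B : H →L[ℂ] H)) (basis H i)‖ₑ ^ 2 := by
    rw [tsum_enorm_sq_adjoint (basis H) (basis H), star_add, star_smul, hA.star_eq, hB.star_eq]
    simp
  rw [trace, (hasSum_inner_mul A.2 B.2 _ rfl (basis H)).tsum_eq, h, sub_self, zero_mul, add_zero,
    ← Complex.ofReal_sub]
  norm_cast

theorem trace_mul_eq (A B : T2 H) :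
    trace ((A : H →L[ℂ] H) * (B : H →L[ℂ] H)) = (⟪toFamily H A, toFamily H B⟫_ℝ : ℝ) := by
  apply Complex.ext
  · rw [Complex.ofReal_re, inner_toFamily]
  · rw [trace_mul_im, Complex.ofReal_im]

theorem schattenNorm_two_eq (A : T2 H) :
    schattenNorm 2 (A : H →L[ℂ] H) = ENNReal.ofReal ‖toFamily H A‖ := by
  have hA := (mem_hermitianClass_two_iff.1 A.2).2
  have h := (hasSum_norm_sq (basis H) hA).tsum_eq
  have h2 := norm_toFamily_sq A
  rw [h] at h2
  rw [schattenNorm_two, ← ENNReal.ofReal_toReal hA.ne, ← h2,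
    ENNReal.ofReal_rpow_of_nonneg (by positivity) (by norm_num), ← Real.sqrt_eq_rpow,
    Real.sqrt_sq (norm_nonneg _)]

theorem pureStates_subset_two : pureStates H ⊆ hermitianClass H 2 := by
  rintro X ⟨ψ, hψ, rfl⟩
  rw [mem_hermitianClass_two_iff]
  refine ⟨(InnerProductSpace.isPositive_rankOne_self ψ).isSelfAdjoint, ?_⟩
  have h : ∀ i, ‖InnerProductSpace.rankOne ℂ ψ ψ (basis H i)‖ₑ ^ 2 = ‖⟪basis H i, ψ⟫_ℂ‖ₑ ^ 2 := by
    intro i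
    have hψ' : ‖ψ‖ₑ = 1 := by rw [← ofReal_norm, hψ, ENNReal.ofReal_one]
    rw [InnerProductSpace.rankOne_apply, enorm_smul, hψ', mul_one,
      ← inner_conj_symm ψ (basis H i), RCLike.enorm_conj]
  simp only [h, tsum_enorm_inner_sq]
  finiteness

/-- A pure state, regarded as an element of `T_2(H)`. -/
def pureToT2 (X : pureStates H) : T2 H := ⟨X, pureStates_subset_two X.2⟩

/-- Lets a linear relation between pure states in `T1 H` be read in `T2 H`, where the inner product
is available. -/
theorem coe_linearCombination_pureToT1 (c : pureStates H →₀ ℝ) :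
    (Finsupp.linearCombination ℝ pureToT1 c : H →L[ℂ] H) =
      (Finsupp.linearCombination ℝ pureToT2 c : T2 H) := by
  simp [Finsupp.linearCombination_apply, Finsupp.sum, pureToT1, pureToT2]

/-- A crude count: the real dimension of all operators. Self-adjointness would save the factor 2,
but the final constant has room for it. -/
theorem finrank_T2_le [FiniteDimensional ℂ H] :
    Module.finrank ℝ (T2 H) ≤ 2 * Module.finrank ℂ H ^ 2 := by
  have e : Module.finrank ℝ (H →L[ℂ] H) = 2 * Module.finrank ℂ H ^ 2 := by
    rw [finrank_real_of_complex, sq, ← Module.finrank_linearMap ℂ ℂ H H]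
    exact congrArg _ (LinearMap.toContinuousLinearMap (𝕜 := ℂ) (E := H) (F' := H)).finrank_eq.symm
  have : FiniteDimensional ℝ (H →L[ℂ] H) := FiniteDimensional.complexToReal _
  exact (Submodule.finrank_le _).trans_eq e

end Embedding

/-! ### Approximate symmetries are approximately linear -/

section Stability

variable {H : Type*} [NormedAddCommGroup H] [InnerProductSpace ℂ H] [CompleteSpace H]

variable {ε : ℝ} {f : pureStates H → T2 H}

/-- The common core of (i) and (ii): the hypothesis on `f` says exactly that the Gram matrices of
the families `f X` and `X` are entrywise `ε`-close. -/
theorem exists_linearMap_inner_toFamily_sub_le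
    (hf : ∀ X Y : pureStates H, ‖trace ((f X : H →L[ℂ] H) * (f Y : H →L[ℂ] H)) -
      trace ((X : H →L[ℂ] H) * (Y : H →L[ℂ] H))‖ ≤ ε)
    (a : SquareSummable H) :
    ∃ l : T1 H →ₗ[ℝ] ℝ, ∀ X, |⟪a, toFamily H (f X)⟫_ℝ - l (pureToT1 X)| ≤ ‖a‖ * √ε := by
  -- A pure state is needed to deduce `0 ≤ ε` from `hf`; if there is none, the claim is vacuous.
  rcases isEmpty_or_nonempty (pureStates H) with h | ⟨⟨X⟩⟩
  · exact ⟨0, fun X => h.elim X⟩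
  refine exists_linearMap_inner_sub_le pureToT1 (fun X => toFamily H (pureToT2 X))
    (fun X => toFamily H (f X)) ((norm_nonneg _).trans (hf X X)) (fun X Y => ?_) (fun c hc => ?_) a
  · have h := hf X Y
    have e : trace ((X : H →L[ℂ] H) * (Y : H →L[ℂ] H)) = _ :=
      trace_mul_eq (pureToT2 X) (pureToT2 Y)
    rwa [trace_mul_eq, e, ← Complex.ofReal_sub, Complex.norm_real, Real.norm_eq_abs] at h
  · have h : Finsupp.linearCombination ℝ pureToT2 c = 0 := by
      apply Subtype.ext
      rw [← coe_linearCombination_pureToT1, hc]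
      rfl
    have h' := congrArg (toFamily H) h
    rwa [Finsupp.apply_linearCombination, map_zero] at h'

/-- Each matrix element of an approximate symmetry is approximated by a linear map. -/
theorem exists_linearMap_trace_mul_sub_le
    (hf : ∀ X Y : pureStates H, ‖trace ((f X : H →L[ℂ] H) * (f Y : H →L[ℂ] H)) -
      trace ((X : H →L[ℂ] H) * (Y : H →L[ℂ] H))‖ ≤ ε) (A : T2 H) :
    ∃ T : T1 H →ₗ[ℝ] T2 H, ∀ X : pureStates H,
      ‖trace ((A : H →L[ℂ] H) * ((f X : H →L[ℂ] H) - (T (pureToT1 X) : H →L[ℂ] H)))‖ ≤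
        ‖toFamily H A‖ * √ε := by
  obtain ⟨l, hl⟩ := exists_linearMap_inner_toFamily_sub_le hf (toFamily H A)
  -- Normalized so that pairing with `A` returns `l`. For `A = 0` the inverse is `0`, and both sides
  -- of the bound vanish.
  refine ⟨(‖toFamily H A‖ ^ 2)⁻¹ • l.smulRight A, fun X => ?_⟩
  rw [← Submodule.coe_sub, trace_mul_eq, Complex.norm_real, Real.norm_eq_abs]
  rcases eq_or_ne (toFamily H A) 0 with h0 | h0
  · simp [h0]
  have hn : ‖toFamily H A‖ ^ 2 ≠ 0 := by simpa using h0
  convert hl X using 2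
  rw [map_sub, inner_sub_right, LinearMap.smul_apply, LinearMap.smulRight_apply, map_smul,
    map_smul, real_inner_smul_right, real_inner_smul_right, real_inner_self_eq_norm_sq]
  field_simp

/-- In finite dimension an approximate symmetry is approximated by a linear map. -/
theorem exists_linearMap_norm_toFamily_sub_le [FiniteDimensional ℂ H]
    (hf : ∀ X Y : pureStates H, ‖trace ((f X : H →L[ℂ] H) * (f Y : H →L[ℂ] H)) -
      trace ((X : H →L[ℂ] H) * (Y : H →L[ℂ] H))‖ ≤ ε) :
    ∃ T : T1 H →ₗ[ℝ] T2 H, ∀ X : pureStates H,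
      ‖toFamily H (f X - T (pureToT1 X))‖ ≤ √(2 * Module.finrank ℂ H ^ 2) * √ε := by
  have : FiniteDimensional ℝ (H →L[ℂ] H) := FiniteDimensional.complexToReal _
  -- `T2 H` inherits the operator norm, so the orthonormal basis is taken in its isometric image and
  -- pulled back to operators `B k`.
  let R := LinearMap.range (toFamily H)
  let b := stdOrthonormalBasis ℝ R
  choose l hl using fun k => exists_linearMap_inner_toFamily_sub_le hf (b k : SquareSummable H)
  choose B hB using fun k => (b k).2
  refine ⟨∑ k, (l k).smulRight (B k), fun X => ?_⟩
  set Z := f X - (∑ k, (l k).smulRight (B k)) (pureToT1 X) with hZ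
  let z : R := ⟨toFamily H Z, LinearMap.mem_range_self _ Z⟩
  have hb : ∀ k k', ⟪(b k : SquareSummable H), b k'⟫_ℝ = if k = k' then 1 else 0 :=
    fun k k' => orthonormal_iff_ite.1 b.orthonormal k k'
  -- By orthonormality the `k`-th coordinate of the error involves only `l k`, so each coordinate is
  -- at most `√ε`.
  have hz : ∀ k, ⟪b k, z⟫_ℝ = ⟪(b k : SquareSummable H), toFamily H (f X)⟫_ℝ -
      l k (pureToT1 X) := by
    intro k
    change ⟪(b k : SquareSummable H), toFamily H Z⟫_ℝ = _
    simp only [hZ, map_sub, LinearMap.sum_apply, map_sum, LinearMap.smulRight_apply, map_smul, hB,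
      inner_sub_right, inner_sum, real_inner_smul_right, hb]
    simp
  have hn : ‖toFamily H Z‖ ^ 2 ≤ 2 * Module.finrank ℂ H ^ 2 * √ε ^ 2 := by
    calc ‖toFamily H Z‖ ^ 2 = ‖z‖ ^ 2 := rfl
      _ = ∑ k, ‖⟪b k, z⟫_ℝ‖ ^ 2 := (b.sum_sq_norm_inner_right z).symm
      _ ≤ ∑ k : Fin (Module.finrank ℝ R), √ε ^ 2 := by
        refine Finset.sum_le_sum fun k _ => ?_
        have h1 : ‖(b k : SquareSummable H)‖ = 1 := b.orthonormal.1 k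
        have h2 := hl k X
        rw [h1, one_mul] at h2
        rw [hz, Real.norm_eq_abs]
        gcongr
      _ = Module.finrank ℝ R * √ε ^ 2 := by simp
      _ ≤ _ := by
        gcongr
        exact_mod_cast (LinearMap.finrank_range_le _).trans finrank_T2_le
  rw [← abs_of_nonneg (norm_nonneg (toFamily H Z)), ← Real.sqrt_sq (Real.sqrt_nonneg ε),
    ← Real.sqrt_mul (by positivity)]
  exact Real.abs_le_sqrt hn

end Stability

end Schatten

theorem theorem1 {H : Type*} [NormedAddCommGroup H] [InnerProductSpace ℂ H] [CompleteSpace H]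
    [TopologicalSpace.SeparableSpace H] (ε : ℝ) (f : Schatten.pureStates H → Schatten.T2 H)
    (hf : ∀ X Y : Schatten.pureStates H,
      ‖Schatten.trace ((f X : H →L[ℂ] H) * (f Y : H →L[ℂ] H)) -
        Schatten.trace ((X : H →L[ℂ] H) * (Y : H →L[ℂ] H))‖ ≤ ε) :
    (∀ A : Schatten.T2 H, Schatten.schattenNorm 2 (A : H →L[ℂ] H) ≤ 1 →
      ∃ T : Schatten.T1 H →ₗ[ℝ] Schatten.T2 H, ∀ X : Schatten.pureStates H,
        ‖Schatten.trace ((A : H →L[ℂ] H) *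
          ((f X : H →L[ℂ] H) - (T (Schatten.pureToT1 X) : H →L[ℂ] H)))‖ ≤ 4 * √ε) ∧
    (∀ d : ℕ, FiniteDimensional ℂ H → Module.finrank ℂ H = d →
      ∃ T : Schatten.T1 H →ₗ[ℝ] Schatten.T2 H, ∀ X : Schatten.pureStates H,
        Schatten.schattenNorm 2 ((f X : H →L[ℂ] H) - (T (Schatten.pureToT1 X) : H →L[ℂ] H)) ≤
          ENNReal.ofReal (4 * d * √ε)) := by
  refine ⟨fun A hA => ?_, fun d _ hd => ?_⟩
  · obtain ⟨T, hT⟩ := Schatten.exists_linearMap_trace_mul_sub_le hf A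
    refine ⟨T, fun X => (hT X).trans ?_⟩
    rw [Schatten.schattenNorm_two_eq, ENNReal.ofReal_le_one] at hA
    nlinarith [Real.sqrt_nonneg ε]
  · obtain ⟨T, hT⟩ := Schatten.exists_linearMap_norm_toFamily_sub_le hf
    refine ⟨T, fun X => ?_⟩
    rw [← Submodule.coe_sub, Schatten.schattenNorm_two_eq]
    refine ENNReal.ofReal_le_ofReal ((hT X).trans ?_)
    gcongr
    rw [hd]
    refine Real.sqrt_le_iff.2 ⟨by positivity, ?_⟩
    -- This is `2 d² ≤ (4 d)²`.
    nlinarith [sq_nonneg (d : ℝ)]
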